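/- Let $X$ be a complex Banach space. Let $\mathrm{Gen}(X)$ be the set of generators of uniformly bounded $C_0$ semigroups on $X$; a tuple $A=(A_1,\dots,A_n)\in\mathrm{Gen}(X)^n$ is called a commuting family if the corresponding semigroups $T_{A_1},\dots,T_{A_n}$ pairwise commute, and then $T_A(u):=T_{A_1}(u_1)\cdots T_{A_n}(u_n)$ for $u\in\mathbb{R}_+^n$ and $D(A):=\bigcap_j D(A_j)$. Let $\mathcal{T}_n$ be the class of nonpositive functions $\psi\in C^\infty((-\infty,0)^n)$ all of whose first partial derivatives are absolutely monotone (that is, nonnegative together with their partial derivatives of all orders). Every $\psi\in\mathcal{T}_n$ has a unique representation $$\psi(s)=c_0+c_1\cdot s+\int_{\mathbb{R}_+^n\setminus\{0\}}(e^{s\cdot u}-1)\,d\mu(u)\qquad(s\in(-\infty,0)^n)$$ with $c_0\in\mathbb{R}$, $c_1\in\mathbb{R}_+^n$ and a positive measure $\mu$ on $\mathbb{R}_+^n\setminus\{0\}$, and for a commuting family $A$ the operator $\psi(A)$ is the closure of the operator $$x\mapsto c_0x+\sum_{j=1}^n c_1^jA_jx+\int_{\mathbb{R}_+^n\setminus\{0\}}(T_A(u)-I)x\,d\mu(u),\qquad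 x\in D(A).$$ Let $\psi\in\mathcal{T}_n$, and let $A=(A_1,\dots,A_n)$ and $B=(B_1,\dots,B_n)$ be commuting families from $\mathrm{Gen}(X)^n$ such that, for $i=1,\dots,n$, $D(A_i)=D(B_i)$ and $A_i-B_i$ is compact. Then $\psi(A)-\psi(B)$ is compact. Here a difference of unbounded operators is called compact if it is densely defined and is the restriction to its domain of a compact operator on $X$; moreover, $D(\psi(A))=D(\psi(B))$. -/

import Mathlib

open Filter Topology MeasureTheory
open scoped NNReal ContDiff

noncomputable section

namespace BochnerPhillips

/-! ### The class of nonpositive Bernstein functions of several variables -/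

/-- The open negative orthant `(-∞, 0)ⁿ`. -/
def negOrthant (n : ℕ) : Set (Fin n → ℝ) := {s | ∀ i, s i < 0}

/-- Absolutely monotone functions on `(-∞, 0)ⁿ`: smooth, and nonnegative there together with the
partial derivatives of all orders `∂ᵏ f / ∂s_{i 0} ⋯ ∂s_{i (k-1)}`. -/
structure IsAbsolutelyMonotone {n : ℕ} (f : (Fin n → ℝ) → ℝ) : Prop where
  contDiffOn : ContDiffOn ℝ ∞ f (negOrthant n)
  nonneg : ∀ (k : ℕ) (i : Fin k → Fin n), ∀ s ∈ negOrthant n,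
    0 ≤ iteratedFDeriv ℝ k f s (fun l => Pi.single (i l) (1 : ℝ))

/-- The class `𝒯_n`: nonpositive smooth functions on `(-∞, 0)ⁿ` all of whose first partial
derivatives are absolutely monotone. (The values outside of `(-∞, 0)ⁿ` are irrelevant.) -/
structure IsBernstein {n : ℕ} (ψ : (Fin n → ℝ) → ℝ) : Prop where
  contDiffOn : ContDiffOn ℝ ∞ ψ (negOrthant n)
  nonpos : ∀ s ∈ negOrthant n, ψ s ≤ 0
  partial_mono : ∀ j : Fin n,
    IsAbsolutelyMonotone (fun s => fderiv ℝ ψ s (Pi.single j (1 : ℝ)))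

/-- The data `(c₀, c₁, μ)` of an integral representation
`ψ(s) = c₀ + c₁ · s + ∫ (e^{s · u} - 1) dμ(u)`. A measure on `ℝ₊ⁿ \ {0}` is regarded as a measure
on `ℝ₊ⁿ` that does not charge the origin. -/
structure LevyData (n : ℕ) where
  c₀ : ℝ
  c₁ : Fin n → ℝ≥0
  μ : Measure (Fin n → ℝ≥0)
  μ_zero : μ {0} = 0
  integrable_exp : ∀ s ∈ negOrthant n,
    Integrable (fun u : Fin n → ℝ≥0 => Real.exp (∑ i, s i * (u i : ℝ)) - 1) μ

/-- `d` represents `ψ` on `(-∞, 0)ⁿ`. -/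
def LevyData.Represents {n : ℕ} (d : LevyData n) (ψ : (Fin n → ℝ) → ℝ) : Prop :=
  ∀ s ∈ negOrthant n,
    ψ s = d.c₀ + ∑ i, (d.c₁ i : ℝ) * s i
      + ∫ u : Fin n → ℝ≥0, (Real.exp (∑ i, s i * (u i : ℝ)) - 1) ∂d.μ

open Classical in
/-- The integral representation of `ψ`; every `ψ` in `𝒯_n` has exactly one. The zero data for a
function without a representation are a placeholder outside of `𝒯_n`. -/
def levyData {n : ℕ} (ψ : (Fin n → ℝ) → ℝ) : LevyData n :=
  if h : ∃ d : LevyData n, d.Represents ψ then h.choose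
  else { c₀ := 0, c₁ := 0, μ := 0, μ_zero := by simp, integrable_exp := by simp }

/-! ### Uniformly bounded `C₀` semigroups and their generators -/

variable {X : Type*} [NormedAddCommGroup X] [NormedSpace ℂ X]

variable (X) in
/-- Uniformly bounded strongly continuous one-parameter semigroups on `X`. -/
structure BddC0Semigroup where
  T : ℝ≥0 → X →L[ℂ] X
  map_zero : T 0 = 1
  map_add : ∀ s t, T (s + t) = T s * T t
  continuous : ∀ x, Continuous fun t => T t x
  bounded : ∃ M : ℝ, ∀ t, ‖T t‖ ≤ M

/-- `x` is in the domain of the generator and the generator maps it to `y`. -/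
def BddC0Semigroup.HasGeneratorAt (S : BddC0Semigroup X) (x y : X) : Prop :=
  Tendsto (fun t : ℝ≥0 => (t : ℂ)⁻¹ • (S.T t x - x)) (𝓝[>] 0) (𝓝 y)

theorem BddC0Semigroup.HasGeneratorAt.add {S : BddC0Semigroup X} {x y x' y' : X}
    (h : S.HasGeneratorAt x y) (h' : S.HasGeneratorAt x' y') :
    S.HasGeneratorAt (x + x') (y + y') := by
  refine (Tendsto.add h h').congr fun t => ?_
  rw [← smul_add, _root_.map_add]
  congr 1
  abel

theorem BddC0Semigroup.HasGeneratorAt.smul {S : BddC0Semigroup X} {x y : X}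
    (h : S.HasGeneratorAt x y) (c : ℂ) : S.HasGeneratorAt (c • x) (c • y) := by
  refine (Tendsto.const_smul h c).congr fun t => ?_
  rw [smul_comm, smul_sub, map_smul]

theorem BddC0Semigroup.hasGeneratorAt_zero (S : BddC0Semigroup X) : S.HasGeneratorAt 0 0 := by
  simp [BddC0Semigroup.HasGeneratorAt]

/-- The infinitesimal generator `A x = lim_{t → 0+} (T(t) x - x) / t`, with domain the set of all
`x` for which the limit exists. -/
def BddC0Semigroup.generator (S : BddC0Semigroup X) : X →ₗ.[ℂ] X where
  domain :=
    { carrier := {x | ∃ y, S.HasGeneratorAt x y}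
      add_mem' := fun ⟨_, h⟩ ⟨_, h'⟩ => ⟨_, h.add h'⟩
      zero_mem' := ⟨0, S.hasGeneratorAt_zero⟩
      smul_mem' := fun c _ ⟨_, h⟩ => ⟨_, h.smul c⟩ }
  toFun :=
    { toFun := fun x => Classical.choose x.2
      map_add' := fun x x' => tendsto_nhds_unique (Classical.choose_spec (x + x').2)
        (BddC0Semigroup.HasGeneratorAt.add (Classical.choose_spec x.2)
          (Classical.choose_spec x'.2))
      map_smul' := fun c x => tendsto_nhds_unique (Classical.choose_spec (c • x).2)
        (BddC0Semigroup.HasGeneratorAt.smul (Classical.choose_spec x.2) c) }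

theorem BddC0Semigroup.generator_spec (S : BddC0Semigroup X) (x : S.generator.domain) :
    S.HasGeneratorAt x (S.generator x) :=
  Classical.choose_spec x.2

variable (X) in
/-- `Gen(X)`: the generators of uniformly bounded `C₀` semigroups on `X`. -/
def Gen : Set (X →ₗ.[ℂ] X) := {A | ∃ S : BddC0Semigroup X, S.generator = A}

/-- The semigroup `T_A` generated by `A` (a `C₀` semigroup is determined by its generator). -/
def semigroup (A : Gen X) : BddC0Semigroup X := A.2.choose

theorem semigroup_generator (A : Gen X) : (semigroup A).generator = A.1 := A.2.choose_spec

/-- Commutation of the operators of a family in `Gen(X)` means commutation of the corresponding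
semigroups. -/
def IsCommutingFamily {n : ℕ} (A : Fin n → Gen X) : Prop :=
  ∀ (i j : Fin n) (s t : ℝ≥0), Commute ((semigroup (A i)).T s) ((semigroup (A j)).T t)

/-- `T_A(u) = T_{A_1}(u_1) ⋯ T_{A_n}(u_n)`. -/
def multiSemigroup {n : ℕ} (A : Fin n → Gen X) (u : Fin n → ℝ≥0) : X →L[ℂ] X :=
  (List.ofFn fun i => (semigroup (A i)).T (u i)).prod

/-- `D(A) = ⋂ D(A_j)`. -/
def jointDomain {n : ℕ} (A : Fin n → Gen X) : Submodule ℂ X := ⨅ i, (A i).1.domain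

theorem jointDomain_le {n : ℕ} (A : Fin n → Gen X) (i : Fin n) :
    jointDomain A ≤ (A i).1.domain := iInf_le _ i

/-! ### Integrability of `u ↦ T_A(u) x - x` for `x ∈ D(A)` -/

theorem BddC0Semigroup.continuous_comp (S : BddC0Semigroup X) {Y : Type*} [TopologicalSpace Y]
    {t : Y → ℝ≥0} {v : Y → X} (ht : Continuous t) (hv : Continuous v) :
    Continuous fun y => S.T (t y) (v y) := by
  obtain ⟨M, hM⟩ := S.bounded
  rw [continuous_iff_continuousAt]
  intro y₀
  have h1 : Tendsto (fun y => S.T (t y) (v y₀)) (𝓝 y₀) (𝓝 (S.T (t y₀) (v y₀))) :=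
    (((S.continuous (v y₀)).comp ht).tendsto y₀)
  have h2 : Tendsto (fun y => S.T (t y) (v y - v y₀)) (𝓝 y₀) (𝓝 0) := by
    have h3 : Tendsto (fun y => M * ‖v y - v y₀‖) (𝓝 y₀) (𝓝 0) := by
      have : Continuous fun y => M * ‖v y - v y₀‖ := by fun_prop
      simpa using this.tendsto y₀
    refine squeeze_zero_norm (fun y => ?_) h3
    exact (S.T (t y)).le_of_opNorm_le (hM _) _
  have h4 := h2.add h1
  rw [zero_add] at h4
  exact h4.congr fun y => by rw [← _root_.map_add, sub_add_cancel]

theorem continuous_multiSemigroup {n : ℕ} (A : Fin n → Gen X) (x : X) :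
    Continuous fun u => multiSemigroup A u x := by
  induction n with
  | zero => simpa [multiSemigroup] using continuous_const
  | succ n ih =>
    have h := (semigroup (A 0)).continuous_comp (Y := Fin (n + 1) → ℝ≥0) (t := fun u => u 0)
      (v := fun u => multiSemigroup (fun i => A i.succ) (fun i => u i.succ) x)
      (by fun_prop) ((ih fun i => A i.succ).comp (by fun_prop))
    simpa [multiSemigroup, List.ofFn_succ] using h

theorem BddC0Semigroup.norm_sub_le (S : BddC0Semigroup X) {x y : X} (h : S.HasGeneratorAt x y) :
    ∃ C : ℝ, 0 ≤ C ∧ ∀ t : ℝ≥0, ‖S.T t x - x‖ ≤ C * (1 - Real.exp (-t)) := by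
  obtain ⟨M, hM⟩ := S.bounded
  have hM0 : 0 ≤ M := (norm_nonneg _).trans (hM 0)
  have h1 : ∀ᶠ t : ℝ≥0 in 𝓝[>] 0, ‖(t : ℂ)⁻¹ • (S.T t x - x)‖ < ‖y‖ + 1 :=
    (Tendsto.norm h).eventually_lt_const (by linarith)
  obtain ⟨δ, hδ, hδt⟩ := (mem_nhdsGT_iff_exists_Ioo_subset).1 h1
  have hδ' : (0 : ℝ) < δ := hδ
  have hpos : 0 < 1 - Real.exp (-(δ : ℝ)) := by
    have := Real.exp_lt_one_iff.2 (neg_lt_zero.2 hδ'); linarith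
  refine ⟨(‖y‖ + 1) * Real.exp δ + (M + 1) * ‖x‖ / (1 - Real.exp (-(δ : ℝ))), by positivity,
    fun t => ?_⟩
  have h0 : 0 ≤ 1 - Real.exp (-(t : ℝ)) := by
    have := Real.exp_le_one_iff.2 (neg_nonpos.2 t.2); linarith!
  rw [add_mul]
  rcases lt_or_ge t δ with ht | ht
  · refine le_add_of_le_of_nonneg ?_ (by positivity)
    rcases eq_or_ne t 0 with rfl | ht0
    · simp [S.map_zero]
    have htp : (0 : ℝ) < t := by exact_mod_cast pos_iff_ne_zero.2 ht0
    have h2 : ‖(t : ℂ)⁻¹ • (S.T t x - x)‖ < ‖y‖ + 1 := hδt ⟨pos_iff_ne_zero.2 ht0, ht⟩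
    rw [norm_smul, norm_inv, show ‖(t : ℂ)‖ = (t : ℝ) by simp,
      inv_mul_lt_iff₀ htp] at h2
    have h3 : (t : ℝ) ≤ Real.exp δ * (1 - Real.exp (-(t : ℝ))) := by
      have e1 : (t : ℝ) + 1 ≤ Real.exp t := Real.add_one_le_exp _
      have e2 : Real.exp (t : ℝ) ≤ Real.exp δ := Real.exp_le_exp.2 (by exact_mod_cast ht.le)
      have e3 : Real.exp (t : ℝ) * Real.exp (-(t : ℝ)) = 1 := by rw [← Real.exp_add]; simp
      nlinarith
    calc ‖S.T t x - x‖ ≤ (‖y‖ + 1) * t := by linarith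
      _ ≤ (‖y‖ + 1) * (Real.exp δ * (1 - Real.exp (-(t : ℝ)))) := by gcongr
      _ = _ := by ring
  · refine le_add_of_nonneg_of_le (by positivity) ?_
    have h4 : Real.exp (-(t : ℝ)) ≤ Real.exp (-(δ : ℝ)) :=
      Real.exp_le_exp.2 (neg_le_neg (by exact_mod_cast ht))
    calc ‖S.T t x - x‖ ≤ ‖S.T t x‖ + ‖x‖ := _root_.norm_sub_le _ _
      _ ≤ M * ‖x‖ + ‖x‖ := by gcongr; exact (S.T t).le_of_opNorm_le (hM t) x
      _ = (M + 1) * ‖x‖ / (1 - Real.exp (-(δ : ℝ))) * (1 - Real.exp (-(δ : ℝ))) := by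
        field_simp
      _ ≤ _ := by gcongr

theorem norm_multiSemigroup_sub_le {n : ℕ} (A : Fin n → Gen X) {x : X}
    (hx : ∀ i, x ∈ (A i).1.domain) :
    ∃ C : ℝ, 0 ≤ C ∧ ∀ u : Fin n → ℝ≥0,
      ‖multiSemigroup A u x - x‖ ≤ C * (1 - Real.exp (-∑ i, (u i : ℝ))) := by
  induction n with
  | zero => exact ⟨0, le_rfl, fun u => by simp [multiSemigroup]⟩
  | succ n ih =>
    obtain ⟨C, hC, hCu⟩ := ih (fun i => A i.succ) (fun i => hx i.succ)
    have hx0 := hx 0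
    rw [← semigroup_generator (A 0)] at hx0
    obtain ⟨y, hy⟩ := hx0
    obtain ⟨D, hD, hDt⟩ := (semigroup (A 0)).norm_sub_le hy
    obtain ⟨M, hM⟩ := (semigroup (A 0)).bounded
    have hM0 : 0 ≤ M := (norm_nonneg _).trans (hM 0)
    refine ⟨M * C + D, by positivity, fun u => ?_⟩
    set P := multiSemigroup (fun i => A i.succ) (fun i => u i.succ) with hP
    have hsplit : multiSemigroup A u x - x
        = (semigroup (A 0)).T (u 0) (P x - x) + ((semigroup (A 0)).T (u 0) x - x) := by
      simp [hP, multiSemigroup, List.ofFn_succ]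
    have hs : 0 ≤ ∑ i : Fin n, (u i.succ : ℝ) := Finset.sum_nonneg fun i _ => (u i.succ).2
    have hu0 : (0 : ℝ) ≤ u 0 := (u 0).2
    rw [hsplit, Fin.sum_univ_succ, add_mul]
    refine (norm_add_le _ _).trans (add_le_add ?_ ?_)
    · refine ((semigroup (A 0)).T (u 0)).le_of_opNorm_le (hM _) _ |>.trans ?_
      rw [mul_assoc]
      refine mul_le_mul_of_nonneg_left ((hCu _).trans ?_) hM0
      gcongr
      linarith
    · refine (hDt _).trans ?_
      gcongr
      linarith

/-- The integrand in the definition of `ψ(A) x` is integrable for `x ∈ D(A)`. -/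
theorem integrable_multiSemigroup_sub {n : ℕ} (d : LevyData n) (A : Fin n → Gen X) {x : X}
    (hx : x ∈ jointDomain A) : Integrable (fun u => multiSemigroup A u x - x) d.μ := by
  obtain ⟨C, _, hCu⟩ := norm_multiSemigroup_sub_le A fun i => jointDomain_le A i hx
  have hint := ((d.integrable_exp (fun _ => -1) (fun _ => by norm_num)).const_mul (-C))
  refine hint.mono' ?_ (Eventually.of_forall fun u => (hCu u).trans_eq ?_)
  · exact ((continuous_multiSemigroup A x).sub continuous_const).aestronglyMeasurable
  · simp only [neg_one_mul, Finset.sum_neg_distrib]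
    ring

/-! ### The functional calculus -/

/-- The operator `x ↦ c₀ x + c₁ · A x + ∫ (T_A(u) - I) x dμ(u)` with domain `D(A)`. -/
def preValue {n : ℕ} (d : LevyData n) (A : Fin n → Gen X) : X →ₗ.[ℂ] X where
  domain := jointDomain A
  toFun :=
    { toFun := fun x => (d.c₀ : ℂ) • (x : X)
        + ∑ i, (d.c₁ i : ℂ) • (A i).1 (Submodule.inclusion (jointDomain_le A i) x)
        + ∫ u, (multiSemigroup A u (x : X) - x) ∂d.μ
      map_add' := fun x y => by
        have h : ∫ u, (multiSemigroup A u ((x : X) + y) - (x + y)) ∂d.μ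
            = (∫ u, (multiSemigroup A u (x : X) - x) ∂d.μ)
              + ∫ u, (multiSemigroup A u (y : X) - y) ∂d.μ := by
          rw [← integral_add (integrable_multiSemigroup_sub d A x.2)
            (integrable_multiSemigroup_sub d A y.2)]
          refine integral_congr_ae (Eventually.of_forall fun u => ?_)
          simp only [_root_.map_add]
          abel
        rw [Submodule.coe_add, h]
        simp only [_root_.map_add, LinearPMap.map_add, smul_add, Finset.sum_add_distrib]
        abel
      map_smul' := fun c x => by
        have h : ∫ u, (multiSemigroup A u (c • (x : X)) - c • (x : X)) ∂d.μ
            = c • ∫ u, (multiSemigroup A u (x : X) - x) ∂d.μ := by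
          rw [← integral_smul]
          refine integral_congr_ae (Eventually.of_forall fun u => ?_)
          simp only [map_smul, smul_sub]
        rw [Submodule.coe_smul, h]
        simp only [map_smul, LinearPMap.map_smul, RingHom.id_apply, smul_add,
          Finset.smul_sum, smul_comm c] }

/-- The value `ψ(A)` of `ψ ∈ 𝒯_n` at a commuting family `A` in `Gen(X)ⁿ`: the closure of the
operator `x ↦ c₀ x + c₁ · A x + ∫ (T_A(u) - I) x dμ(u)` on `D(A)`. -/
def value {n : ℕ} (ψ : (Fin n → ℝ) → ℝ) (A : Fin n → Gen X) : X →ₗ.[ℂ] X :=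
  (preValue (levyData ψ) A).closure

/-- A densely defined operator is compact if it is the restriction to its domain of a compact
operator on `X` (which is unique). -/
def IsCompactPMap (f : X →ₗ.[ℂ] X) : Prop :=
  Dense (f.domain : Set X) ∧
    ∃ K : X →L[ℂ] X, IsCompactOperator K ∧ ∀ x : f.domain, f x = K x

end BochnerPhillips

end

/-! The operators whose closures are `value ψ A` and `value ψ B` differ by one compact operator `K`
on their common domain, and adding a bounded operator commutes with closure (`closure_clm_vadd`).
Hence the closures have equal domains and again differ by `K`.

If `K i` extends `A i - B i`, then `K` is the sum of the `c₁ i • K i` and of the strong integral of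
`multiSemigroup A u - multiSemigroup B u` against `μ`. Duhamel's formula writes a difference of
one-parameter semigroups as a strong integral of operators containing the factor `K i`, and
telescoping passes to products.

Both integrals are only strong: the integrands need not be continuous in operator norm, so
compactness cannot be read off from norm limits of Riemann sums. `isCompactOperator_of_integral`
supplies it from an integrable bound on the norms. For `μ` that bound is a multiple of `1 - exp (-∑
u i)`, which is integrable because the Lévy integrand at `s = (-1, …, -1)` is.

Density of the domain comes from averaging along the commuting semigroups (`dense_joint`). -/

namespace BochnerPhillips

open scoped ENNReal

/-! ### Strong integrals of compact operators. -/

section StrongIntegral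

/-- A set all of whose sequences have totally bounded range is totally bounded. -/
theorem totallyBounded_of_seq {α : Type*} [PseudoMetricSpace α] {s : Set α}
    (h : ∀ z : ℕ → α, (∀ k, z k ∈ s) → TotallyBounded (Set.range z)) : TotallyBounded s := by
  rw [Metric.totallyBounded_iff]
  by_contra! hcon
  obtain ⟨ε, hε, hs⟩ := hcon
  -- Without a finite `ε`-net, an `ε`-separated sequence can be chosen; two of its terms then fall
  -- in one ball of radius `ε / 2`.
  obtain ⟨z, hz⟩ := Set.seq_of_forall_finite_exists
    (P := fun c t => c ∈ s ∧ ∀ y ∈ t, ε ≤ dist c y) fun t ht => by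
      obtain ⟨c, hc, hct⟩ := Set.not_subset.1 (hs t ht)
      refine ⟨c, hc, fun y hy => ?_⟩
      by_contra! hlt
      exact hct (Set.mem_biUnion hy hlt)
  have hfar : ∀ m k, m < k → ε ≤ dist (z k) (z m) := fun m k hmk =>
    (hz k).2 _ (Set.mem_image_of_mem z hmk)
  obtain ⟨t, ht, hcov⟩ := Metric.totallyBounded_iff.1 (h z fun k => (hz k).1) (ε / 2) (half_pos hε)
  have hc : ∀ k, ∃ y ∈ t, dist (z k) y < ε / 2 := fun k => by
    simpa using hcov (Set.mem_range_self k)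
  choose y hyt hy using hc
  obtain ⟨m, -, k, -, hne, he⟩ := Set.infinite_univ.exists_ne_map_eq_of_mapsTo
    (f := y) (t := t) (fun k _ => hyt k) ht
  have key : ∀ m k, m < k → y m = y k → False := fun m k hmk he => by
    have h1 := dist_triangle_right (z k) (z m) (y k)
    have h2 := hfar m k hmk
    have h3 := hy k
    have h4 := hy m
    rw [he] at h4
    linarith
  rcases lt_or_gt_of_ne hne with h' | h'
  · exact key _ _ h' he
  · exact key _ _ h' he.symm

variable {X : Type*} [NormedAddCommGroup X] [NormedSpace ℂ X]

/-- A bounded set that lies within every positive distance of some finite-dimensional subspace is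
totally bounded. -/
theorem totallyBounded_of_near_finiteDimensional {s : Set X} {C : ℝ} (hC : ∀ z ∈ s, ‖z‖ ≤ C)
    (h : ∀ ε > 0, ∃ V : Submodule ℂ X, FiniteDimensional ℂ V ∧ ∀ z ∈ s, ∃ v ∈ V, dist z v < ε) :
    TotallyBounded s := by
  rw [Metric.totallyBounded_iff]
  intro ε hε
  obtain ⟨V, hV, hs⟩ := h (ε / 2) (half_pos hε)
  have : ProperSpace V := FiniteDimensional.proper ℂ V
  have hcpt : IsCompact ((↑) '' Metric.closedBall (0 : V) (C + ε) : Set X) :=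
    (isCompact_closedBall _ _).image continuous_subtype_val
  obtain ⟨t, ht, hcov⟩ := Metric.totallyBounded_iff.1 hcpt.totallyBounded (ε / 2) (half_pos hε)
  refine ⟨t, ht, fun z hz => ?_⟩
  obtain ⟨v, hvV, hv⟩ := hs z hz
  have hvn : ‖v‖ ≤ C + ε := by
    have h1 := norm_le_norm_add_norm_sub z v
    rw [dist_eq_norm] at hv
    linarith [hC z hz]
  have hmem : v ∈ ((↑) '' Metric.closedBall (0 : V) (C + ε) : Set X) :=
    ⟨⟨v, hvV⟩, by simpa using hvn, rfl⟩
  obtain ⟨y, hyt, hy⟩ := Set.mem_iUnion₂.1 (hcov hmem)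
  refine Set.mem_biUnion hyt ?_
  have := dist_triangle z v y
  simp only [Metric.mem_ball] at hy ⊢
  linarith

variable [CompleteSpace X]

/-- A dominated strong integral of compact operators is compact. -/
theorem isCompactOperator_of_integral {Ω : Type*} [TopologicalSpace Ω]
    [SecondCountableTopology Ω] [MeasurableSpace Ω] [OpensMeasurableSpace Ω] {μ : Measure Ω}
    {U : Ω → X →L[ℂ] X} (hUc : ∀ x, Continuous fun w => U w x)
    (hU : ∀ w, IsCompactOperator (U w)) {g : Ω → ℝ} (hg : Integrable g μ)
    (hUg : ∀ w, ‖U w‖ ≤ g w) {K : X →L[ℂ] X} (hK : ∀ x, K x = ∫ w, U w x ∂μ) :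
    IsCompactOperator K := by
  refine (isCompactOperator_iff_isCompact_closure_image_closedBall (K : X →ₗ[ℂ] X) one_pos).2 ?_
  refine TotallyBounded.isCompact_of_isClosed ?_ isClosed_closure
  refine TotallyBounded.closure (totallyBounded_of_seq fun z hz => ?_)
  choose x hx hxz using hz
  have hx1 : ∀ k, ‖x k‖ ≤ 1 := fun k => by simpa using hx k
  have hbd : ∀ w k, ‖U w (x k)‖ ≤ g w := fun w k =>
    ((U w).le_of_opNorm_le (hUg w) _).trans
      (mul_le_of_le_one_right ((norm_nonneg _).trans (hUg w)) (hx1 k))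
  have hint : ∀ k, Integrable (fun w => U w (x k)) μ := fun k =>
    hg.mono' (hUc _).aestronglyMeasurable (Eventually.of_forall fun w => hbd w k)
  -- Only countably many vectors `x k` occur, so all values lie in a separable set even if `X` is
  -- not separable. The spans `V m` of initial segments of a dense sequence then approximate every
  -- value.
  have hsep : TopologicalSpace.IsSeparable (⋃ k, Set.range fun w => U w (x k)) :=
    TopologicalSpace.IsSeparable.iUnion fun k => TopologicalSpace.isSeparable_range (hUc (x k))
  obtain ⟨c, hc, hcd⟩ := hsep
  obtain ⟨y, hy⟩ := (hc.insert 0).exists_eq_range (Set.insert_nonempty _ _)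
  have hcd' : ∀ w k, U w (x k) ∈ closure (Set.range y) := fun w k =>
    closure_mono (hy ▸ Set.subset_insert 0 c) (hcd (Set.mem_iUnion.2 ⟨k, w, rfl⟩))
  let V : ℕ → Submodule ℂ X := fun m => Submodule.span ℂ (y '' Set.Iio m)
  have hVfin : ∀ m, FiniteDimensional ℂ (V m) := fun m =>
    FiniteDimensional.span_of_finite ℂ ((Set.finite_Iio m).image y)
  have hVcl : ∀ m, IsClosed (V m : Set X) := fun m => (V m).closed_of_finiteDimensional
  have hVm : Monotone V := fun m m' h => Submodule.span_mono (Set.image_mono (Set.Iio_subset_Iio h))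
  -- The quotient norm is the distance to `V m`. The supremum is countable, hence measurable in `w`:
  -- this is the gain from working with sequences.
  let G : ℕ → Ω → ℝ≥0∞ := fun m w => ⨆ k, ‖(V m).mkQL (U w (x k))‖ₑ
  have hGmeas : ∀ m, Measurable (G m) := fun m =>
    Measurable.iSup fun k => (((V m).mkQL.continuous.comp (hUc (x k))).enorm).measurable
  have hmk : ∀ m (v : X), ‖(V m).mkQL v‖ = Metric.infDist v (V m) := fun m v =>
    QuotientAddGroup.norm_mk (S := (V m).toAddSubgroup) v
  have hGle : ∀ m w, G m w ≤ ENNReal.ofReal (g w) := fun m w => iSup_le fun k => by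
    rw [← ofReal_norm]
    refine ENNReal.ofReal_le_ofReal ?_
    rw [hmk]
    refine (Metric.infDist_le_dist_of_mem (V m).zero_mem).trans ?_
    simpa using hbd w k
  -- A Dini argument: on the compact closure of the orbit under `U w`, the distances to the
  -- increasing `V m` decrease to zero, hence uniformly.
  have hG0 : ∀ w, Tendsto (fun m => G m w) atTop (𝓝 0) := fun w => by
    have hcpt : IsCompact (closure (Set.range fun k => U w (x k))) := by
      refine (IsCompactOperator.isCompact_closure_image_closedBall
        (f := (U w : X →ₗ[ℂ] X)) (hU w) 1).of_isClosed_subset isClosed_closure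
        (closure_mono ?_)
      rintro _ ⟨k, rfl⟩
      exact ⟨x k, hx k, rfl⟩
    rw [ENNReal.tendsto_atTop_zero]
    intro ε hε
    obtain ⟨δ, hδ0, hδ⟩ := ENNReal.lt_iff_exists_nnreal_btwn.1 hε
    have hδ0 : (0 : ℝ) < δ := by simpa using hδ0
    obtain ⟨N, hN⟩ := hcpt.elim_directed_cover (fun m => {v | Metric.infDist v (V m) < δ})
      (fun m => isOpen_lt (Metric.continuous_infDist_pt _) continuous_const)
      (fun v hv => by
        have hv' : v ∈ closure (Set.range y) :=
          closure_minimal (Set.range_subset_iff.2 fun k => hcd' w k) isClosed_closure hv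
        obtain ⟨_, ⟨j, rfl⟩, hj⟩ := Metric.mem_closure_iff.1 hv' δ hδ0
        refine Set.mem_iUnion.2 ⟨j + 1, (Metric.infDist_le_dist_of_mem ?_).trans_lt hj⟩
        exact Submodule.subset_span ⟨j, Nat.lt_succ_self j, rfl⟩)
      (Monotone.directed_le fun m m' h v hv =>
        (Metric.infDist_le_infDist_of_subset (hVm h) ⟨0, (V m).zero_mem⟩).trans_lt hv)
    refine ⟨N, fun m hm => (iSup_le fun k => ?_).trans hδ.le⟩
    have h1 := hN (subset_closure (Set.mem_range_self k))
    have h2 := (Metric.infDist_le_infDist_of_subset (x := U w (x k)) (hVm hm)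
      ⟨0, (V N).zero_mem⟩).trans_lt h1
    rw [← ofReal_norm, hmk]
    exact (ENNReal.ofReal_le_ofReal h2.le).trans_eq (ENNReal.ofReal_coe_nnreal)
  have hlim : Tendsto (fun m => ∫⁻ w, G m w ∂μ) atTop (𝓝 0) := by
    have := tendsto_lintegral_of_dominated_convergence (μ := μ) (F := G) (f := fun _ => 0)
      (fun w => ENNReal.ofReal (g w)) hGmeas (fun m => Eventually.of_forall (hGle m))
      (hg.lintegral_lt_top).ne (Eventually.of_forall hG0)
    simpa using this
  have hz : ∀ k, z k = ∫ w, U w (x k) ∂μ := fun k => by rw [← hK, ← hxz k]; rfl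
  refine totallyBounded_of_near_finiteDimensional (C := ∫ w, g w ∂μ) ?_ fun ε hε => ?_
  · rintro _ ⟨k, rfl⟩
    rw [hz]
    exact norm_integral_le_of_norm_le hg (Eventually.of_forall fun w => hbd w k)
  · obtain ⟨m, hm⟩ := ((hlim.eventually (gt_mem_nhds (ENNReal.ofReal_pos.2 hε)))).exists
    refine ⟨V m, hVfin m, ?_⟩
    rintro _ ⟨k, rfl⟩
    -- Closedness makes the quotient a normed space, so the quotient map can be moved inside the
    -- integral.
    have := hVcl m
    have h1 : ‖(V m).mkQL (z k)‖ₑ < ENNReal.ofReal ε := by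
      rw [hz, ← ContinuousLinearMap.integral_comp_comm _ (hint k)]
      refine (enorm_integral_le_lintegral_enorm _).trans_lt (lt_of_le_of_lt ?_ hm)
      exact lintegral_mono fun w => le_iSup (fun k => ‖(V m).mkQL (U w (x k))‖ₑ) k
    rw [← ofReal_norm, ENNReal.ofReal_lt_ofReal_iff hε, hmk,
      Metric.infDist_lt_iff ⟨0, (V m).zero_mem⟩] at h1
    exact h1

end StrongIntegral

/-! ### Closure and bounded perturbation. -/

section Closure

variable {X : Type*} [NormedAddCommGroup X] [NormedSpace ℂ X]

/-- The shear `(a, b) ↦ (a, b + K a)` is a homeomorphism of `X × X`, so expressing the perturbation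
through it lets closures of graphs be transported. -/
theorem graph_vadd (K : X →L[ℂ] X) (f : X →ₗ.[ℂ] X) :
    ((K : X →ₗ[ℂ] X) +ᵥ f).graph
      = f.graph.map ((ContinuousLinearEquiv.skewProd (.refl ℂ X) (.refl ℂ X) K :
          (X × X) ≃L[ℂ] (X × X)) : X × X →ₗ[ℂ] X × X) := by
  ext ⟨a, b⟩
  simp only [LinearPMap.mem_graph_iff, Submodule.mem_map]
  constructor
  · rintro ⟨x, rfl, rfl⟩
    exact ⟨(x, f x), ⟨x, rfl, rfl⟩, by simp [LinearPMap.vadd_apply, add_comm]⟩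
  · rintro ⟨⟨_, _⟩, ⟨x, rfl, rfl⟩, h⟩
    simp at h
    exact ⟨x, h.1, by simp [LinearPMap.vadd_apply, ← h.2, add_comm]⟩

theorem topologicalClosure_graph_vadd (K : X →L[ℂ] X) (f : X →ₗ.[ℂ] X) :
    ((K : X →ₗ[ℂ] X) +ᵥ f).graph.topologicalClosure
      = f.graph.topologicalClosure.map ((ContinuousLinearEquiv.skewProd (.refl ℂ X) (.refl ℂ X) K :
          (X × X) ≃L[ℂ] (X × X)) : X × X →ₗ[ℂ] X × X) := by
  rw [graph_vadd]
  apply SetLike.coe_injective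
  simp only [Submodule.topologicalClosure_coe, Submodule.map_coe]
  exact ((ContinuousLinearEquiv.skewProd (.refl ℂ X) (.refl ℂ X) K :
          (X × X) ≃L[ℂ] (X × X)).toHomeomorph.image_closure _).symm

theorem isClosable_vadd {K : X →L[ℂ] X} {f : X →ₗ.[ℂ] X} (hf : f.IsClosable) :
    ((K : X →ₗ[ℂ] X) +ᵥ f).IsClosable := by
  obtain ⟨g, hg⟩ := hf
  exact ⟨(K : X →ₗ[ℂ] X) +ᵥ g, by rw [topologicalClosure_graph_vadd, hg, graph_vadd]⟩

/-- Taking closures commutes with adding a bounded operator. -/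
theorem closure_clm_vadd (K : X →L[ℂ] X) (f : X →ₗ.[ℂ] X) :
    ((K : X →ₗ[ℂ] X) +ᵥ f).closure = (K : X →ₗ[ℂ] X) +ᵥ f.closure := by
  by_cases hf : f.IsClosable
  · apply LinearPMap.eq_of_eq_graph
    rw [← (isClosable_vadd hf).graph_closure_eq_closure_graph, topologicalClosure_graph_vadd,
      hf.graph_closure_eq_closure_graph, graph_vadd]
  -- By convention, `closure` leaves a non-closable operator unchanged, so the identity persists and
  -- closability never has to be proved.
  · have hf' : ¬ ((K : X →ₗ[ℂ] X) +ᵥ f).IsClosable := fun h => hf <| by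
      have := isClosable_vadd (K := -K) h
      rwa [vadd_vadd, ContinuousLinearMap.toLinearMap_neg, neg_add_cancel, zero_vadd] at this
    rw [LinearPMap.closure_def' hf, LinearPMap.closure_def' hf']

end Closure

/-! ### Duhamel's formula and differences of semigroups. -/

section Semigroup

variable {X : Type*} [NormedAddCommGroup X] [NormedSpace ℂ X]

/-- A dominated strong integral of bounded operators is a bounded operator. -/
theorem exists_clm_integral {Ω : Type*} [TopologicalSpace Ω]
    [SecondCountableTopology Ω] [MeasurableSpace Ω] [OpensMeasurableSpace Ω] {μ : Measure Ω}
    {U : Ω → X →L[ℂ] X} (hUc : ∀ x, Continuous fun w => U w x) {g : Ω → ℝ} (hg : Integrable g μ)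
    (hUg : ∀ w, ‖U w‖ ≤ g w) :
    ∃ K : X →L[ℂ] X, (∀ x, K x = ∫ w, U w x ∂μ) ∧ ‖K‖ ≤ ∫ w, g w ∂μ := by
  have hbd : ∀ w x, ‖U w x‖ ≤ g w * ‖x‖ := fun w x => (U w).le_of_opNorm_le (hUg w) x
  have hint : ∀ x, Integrable (fun w => U w x) μ := fun x =>
    (hg.mul_const ‖x‖).mono' (hUc x).aestronglyMeasurable (Eventually.of_forall fun w => hbd w x)
  let L : X →ₗ[ℂ] X :=
    { toFun := fun x => ∫ w, U w x ∂μ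
      map_add' := fun x y => by simp only [_root_.map_add, integral_add (hint x) (hint y)]
      map_smul' := fun c x => by simp only [map_smul, integral_smul, RingHom.id_apply] }
  have hL : ∀ x, ‖L x‖ ≤ (∫ w, g w ∂μ) * ‖x‖ := fun x => by
    rw [← integral_mul_const]
    exact norm_integral_le_of_norm_le (hg.mul_const _) (Eventually.of_forall fun w => hbd w x)
  exact ⟨L.mkContinuous _ hL, fun x => rfl, L.mkContinuous_norm_le
    (integral_nonneg fun w => (norm_nonneg _).trans (hUg w)) hL⟩

theorem BddC0Semigroup.continuous_uncurry (S : BddC0Semigroup X) :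
    Continuous fun p : ℝ≥0 × X => S.T p.1 p.2 :=
  S.continuous_comp continuous_fst continuous_snd

theorem BddC0Semigroup.tendsto_apply (S : BddC0Semigroup X) {Y : Type*} {l : Filter Y}
    {t : Y → ℝ≥0} {v : Y → X} {t₀ : ℝ≥0} {v₀ : X} (ht : Tendsto t l (𝓝 t₀))
    (hv : Tendsto v l (𝓝 v₀)) : Tendsto (fun y => S.T (t y) (v y)) l (𝓝 (S.T t₀ v₀)) :=
  (S.continuous_uncurry.tendsto (t₀, v₀)).comp (ht.prodMk_nhds hv)

theorem BddC0Semigroup.commute (S : BddC0Semigroup X) (s t : ℝ≥0) : Commute (S.T s) (S.T t) := by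
  rw [Commute, SemiconjBy, ← S.map_add, ← S.map_add, add_comm]

theorem BddC0Semigroup.T_add_apply (S : BddC0Semigroup X) (s t : ℝ≥0) (x : X) :
    S.T (s + t) x = S.T s (S.T t x) := by
  rw [S.map_add]; rfl

theorem BddC0Semigroup.HasGeneratorAt.map {S : BddC0Semigroup X} {x y : X}
    (h : S.HasGeneratorAt x y) {C : X →L[ℂ] X} (hC : ∀ t, Commute (S.T t) C) :
    S.HasGeneratorAt (C x) (C y) := by
  refine ((C.continuous.tendsto y).comp h).congr fun t => ?_
  have : S.T t (C x) = C (S.T t x) := congrArg (fun F : X →L[ℂ] X => F x) (hC t)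
  simp [this]

theorem BddC0Semigroup.exists_bound (S : BddC0Semigroup X) :
    ∃ M : ℝ, 0 ≤ M ∧ ∀ t, ‖S.T t‖ ≤ M := by
  obtain ⟨M, hM⟩ := S.bounded
  exact ⟨M, (norm_nonneg _).trans (hM 0), hM⟩

theorem tendsto_coe_nhdsGT_zero :
    Tendsto (fun t : ℝ≥0 => (t : ℝ)) (𝓝[>] 0) (𝓝[>] 0) :=
  tendsto_nhdsWithin_of_tendsto_nhds_of_eventually_within _
    ((NNReal.continuous_coe.tendsto 0).mono_left nhdsWithin_le_nhds)
    (eventually_nhdsWithin_of_forall fun t ht => by simpa using ht)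

theorem tendsto_toNNReal_sub_nhdsGT (s : ℝ) :
    Tendsto (fun r : ℝ => (r - s).toNNReal) (𝓝[>] s) (𝓝[>] 0) := by
  refine tendsto_nhdsWithin_of_tendsto_nhds_of_eventually_within _ ?_
    (eventually_nhdsWithin_of_forall fun r hr => by simpa using hr)
  have : Continuous fun r : ℝ => (r - s).toNNReal := by fun_prop
  simpa using (this.tendsto s).mono_left nhdsWithin_le_nhds

/-- The derivative of `s ↦ S(t - s) R(s) x`, where the generator of `S` is that of `R`
plus `K`. -/
theorem hasDerivWithinAt_comp_semigroup {S R : BddC0Semigroup X} {K : X →L[ℂ] X}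
    (hK : ∀ x y, R.HasGeneratorAt x y → S.HasGeneratorAt x (y + K x)) {x y : X}
    (hxy : R.HasGeneratorAt x y) {s t : ℝ} (hs : 0 ≤ s) (hst : s < t) :
    HasDerivWithinAt (fun r : ℝ => S.T (t - r).toNNReal (R.T r.toNNReal x))
      (-S.T (t - s).toNNReal (K (R.T s.toNNReal x))) (Set.Ioi s) s := by
  rw [hasDerivWithinAt_iff_tendsto_slope' (by simp)]
  set z := R.T s.toNNReal x with hz
  have hRz : R.HasGeneratorAt z (R.T s.toNNReal y) := hxy.map fun r => R.commute _ _
  have hSz := hK _ _ hRz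
  -- The increment from `s` to `r` is `S (t - r)` applied to `R (r - s) z - S (r - s) z`. In the
  -- limit the generator of `R` cancels and only `-K z` remains.
  have h1 := ((Tendsto.sub hRz hSz).comp (tendsto_toNNReal_sub_nhdsGT s))
  have h2 : Tendsto (fun r : ℝ => (t - r).toNNReal) (𝓝[>] s) (𝓝 (t - s).toNNReal) := by
    have : Continuous fun r : ℝ => (t - r).toNNReal := by fun_prop
    exact (this.tendsto s).mono_left nhdsWithin_le_nhds
  have h3 := S.tendsto_apply h2 h1
  rw [sub_add_cancel_left, _root_.map_neg] at h3
  refine h3.congr' ?_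
  filter_upwards [Ioo_mem_nhdsGT hst] with r hr
  have e1 : r.toNNReal = (r - s).toNNReal + s.toNNReal := by
    rw [← Real.toNNReal_add (by linarith [hr.1]) hs]; congr 1; ring
  have e2 : (t - s).toNNReal = (t - r).toNNReal + (r - s).toNNReal := by
    rw [← Real.toNNReal_add (by linarith [hr.2]) (by linarith [hr.1])]; congr 1; ring
  have e3 : (((r - s).toNNReal : ℝ≥0) : ℂ) = ((r - s : ℝ) : ℂ) := by
    rw [Real.coe_toNNReal _ (by linarith [hr.1])]
  simp only [slope, Function.comp_def, vsub_eq_sub]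
  rw [e1, R.T_add_apply, ← hz, e2, S.T_add_apply, ← _root_.map_sub, e3, ← smul_sub,
    sub_sub_sub_cancel_right, ← Complex.ofReal_inv, Complex.coe_smul]
  exact ((S.T (t - r).toNNReal).restrictScalars ℝ).map_smul _ _

/-- Duhamel's formula, for `x` in the domain of the generator. -/
theorem semigroup_sub_apply [CompleteSpace X] {S R : BddC0Semigroup X} {K : X →L[ℂ] X}
    (hK : ∀ x y, R.HasGeneratorAt x y → S.HasGeneratorAt x (y + K x)) {x y : X}
    (hxy : R.HasGeneratorAt x y) (t : ℝ≥0) :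
    (S.T t - R.T t) x
      = ∫ s in Set.Ioc (0 : ℝ) t, S.T (t - s).toNNReal (K (R.T s.toNNReal x)) := by
  -- Used with `L = 1` for the primitive and with `L = K` for its right derivative.
  have hc : ∀ L : X →L[ℂ] X,
      Continuous fun s : ℝ => S.T (t - s).toNNReal (L (R.T s.toNNReal x)) := fun L =>
    S.continuous_comp (by fun_prop)
      (L.continuous.comp ((R.continuous x).comp continuous_real_toNNReal))
  have h := intervalIntegral.integral_eq_sub_of_hasDeriv_right (a := 0) (b := (t : ℝ))
    (f := fun r : ℝ => S.T (t - r).toNNReal (R.T r.toNNReal x))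
    (f' := fun s => -S.T (t - s).toNNReal (K (R.T s.toNNReal x)))
    (hc 1).continuousOn
    (fun s hs => by
      rw [min_eq_left t.coe_nonneg, max_eq_right t.coe_nonneg] at hs
      exact hasDerivWithinAt_comp_semigroup hK hxy hs.1.le hs.2)
    ((hc K).neg.intervalIntegrable _ _)
  rw [intervalIntegral.integral_neg, intervalIntegral.integral_of_le t.coe_nonneg, neg_eq_iff_eq_neg] at h
  rw [h]
  simp [S.map_zero, R.map_zero]

/-- Duhamel's formula extends from the dense domain to all of `X` by continuity, and its integrand
is compact because of the factor `K`. The bound is linear for small `t` and constant for large `t`,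
put in the form that a Lévy measure integrates. -/
theorem semigroup_sub_compact [CompleteSpace X] {S R : BddC0Semigroup X} {K : X →L[ℂ] X}
    (hKc : IsCompactOperator K)
    (hK : ∀ x y, R.HasGeneratorAt x y → S.HasGeneratorAt x (y + K x))
    (hd : Dense {x | ∃ y, R.HasGeneratorAt x y}) :
    ∃ C : ℝ, 0 ≤ C ∧ ∀ t : ℝ≥0, IsCompactOperator (S.T t - R.T t) ∧
      ‖S.T t - R.T t‖ ≤ C * (1 - Real.exp (-(t : ℝ))) := by
  obtain ⟨M, hM0, hM⟩ := S.exists_bound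
  obtain ⟨N, hN0, hN⟩ := R.exists_bound
  refine ⟨Real.exp 1 * (M * ‖K‖ * N + (M + N)), by positivity, fun t => ?_⟩
  let U : ℝ → X →L[ℂ] X := fun s => S.T (t - s).toNNReal ∘L K ∘L R.T s.toNNReal
  have hUc : ∀ x, Continuous fun s => U s x := fun x =>
    S.continuous_comp (by fun_prop)
      (K.continuous.comp ((R.continuous x).comp continuous_real_toNNReal))
  have hUb : ∀ s, ‖U s‖ ≤ M * (‖K‖ * N) := fun s =>
    (ContinuousLinearMap.opNorm_comp_le _ _).trans (mul_le_mul (hM _)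
      ((ContinuousLinearMap.opNorm_comp_le _ _).trans (by gcongr; exact hN _))
      (norm_nonneg _) hM0)
  have hg : Integrable (fun _ : ℝ => M * (‖K‖ * N)) (volume.restrict (Set.Ioc (0 : ℝ) t)) :=
    integrable_const _
  obtain ⟨L, hL, hLn⟩ := exists_clm_integral hUc hg hUb
  have hLe : L = S.T t - R.T t := by
    apply DFunLike.coe_injective
    refine Continuous.ext_on hd L.continuous (S.T t - R.T t).continuous ?_
    rintro x ⟨y, hxy⟩
    exact (hL x).trans (semigroup_sub_apply hK hxy t).symm
  rw [hLe] at hL hLn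
  refine ⟨isCompactOperator_of_integral hUc (fun s => ?_) hg hUb hL, ?_⟩
  · exact (hKc.comp_clm (R.T s.toNNReal)).clm_comp (S.T (t - s).toNNReal)
  have h1 : ‖S.T t - R.T t‖ ≤ M * ‖K‖ * N * t := by
    refine hLn.trans_eq ?_
    simp
    ring
  have h2 : ‖S.T t - R.T t‖ ≤ M + N := (norm_sub_le _ _).trans (add_le_add (hM t) (hN t))
  -- Applied with `r = t` or `r = 1`, this gives `min t 1 ≤ e (1 - exp (-t))`; it follows from `r ≤
  -- exp r - 1 = exp r * (1 - exp (-r))`.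
  have h3 : ∀ r : ℝ, 0 ≤ r → r ≤ 1 → r ≤ t → r ≤ Real.exp 1 * (1 - Real.exp (-(t : ℝ))) := by
    intro r hr0 hr1 hrt
    have e1 : r + 1 ≤ Real.exp r := Real.add_one_le_exp _
    have e2 : Real.exp r ≤ Real.exp 1 := Real.exp_le_exp.2 hr1
    have e3 : Real.exp r * Real.exp (-r) = 1 := by rw [← Real.exp_add]; simp
    have e4 : Real.exp (-(t : ℝ)) ≤ Real.exp (-r) := Real.exp_le_exp.2 (neg_le_neg hrt)
    have e5 : Real.exp (-r) ≤ 1 := Real.exp_le_one_iff.2 (by linarith)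
    calc r ≤ Real.exp r * (1 - Real.exp (-r)) := by linarith
      _ ≤ Real.exp 1 * (1 - Real.exp (-(t : ℝ))) :=
        mul_le_mul e2 (by linarith) (by linarith) (by positivity)
  rcases le_total (t : ℝ) 1 with ht | ht
  · have h4 := h3 t t.2 ht le_rfl
    calc ‖S.T t - R.T t‖ ≤ M * ‖K‖ * N * t := h1
      _ ≤ (M * ‖K‖ * N + (M + N)) * t := by
        refine mul_le_mul_of_nonneg_right ?_ t.2; linarith
      _ ≤ (M * ‖K‖ * N + (M + N)) * (Real.exp 1 * (1 - Real.exp (-(t : ℝ)))) := by gcongr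
      _ = _ := by ring
  · have h4 := h3 1 zero_le_one le_rfl ht
    calc ‖S.T t - R.T t‖ ≤ M + N := h2
      _ ≤ (M * ‖K‖ * N + (M + N)) * 1 := by
        have : 0 ≤ M * ‖K‖ * N := by positivity
        linarith
      _ ≤ (M * ‖K‖ * N + (M + N)) * (Real.exp 1 * (1 - Real.exp (-(t : ℝ)))) := by gcongr
      _ = _ := by ring

theorem exists_bound_multiSemigroup {n : ℕ} (A : Fin n → Gen X) :
    ∃ M : ℝ, 0 ≤ M ∧ ∀ u, ‖multiSemigroup A u‖ ≤ M := by
  induction n with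
  | zero => exact ⟨‖(1 : X →L[ℂ] X)‖, norm_nonneg _, fun u => by simp [multiSemigroup]⟩
  | succ n ih =>
    obtain ⟨M, hM0, hM⟩ := ih fun i => A i.succ
    obtain ⟨N, hN0, hN⟩ := (semigroup (A 0)).exists_bound
    refine ⟨N * M, by positivity, fun u => ?_⟩
    have : multiSemigroup A u = (semigroup (A 0)).T (u 0)
        * multiSemigroup (fun i => A i.succ) (fun i => u i.succ) := by
      simp [multiSemigroup, List.ofFn_succ]
    rw [this]
    exact (norm_mul_le _ _).trans (mul_le_mul (hN _) (hM _) (norm_nonneg _) hN0)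

/-- Telescoping over the factors: each term has one compact difference between bounded operators. No
commutation is needed, and each weight in one group of coordinates is at most the weight in their
total sum. -/
theorem multiSemigroup_sub_compact {n : ℕ} (A B : Fin n → Gen X)
    (h : ∀ i, ∃ C : ℝ, 0 ≤ C ∧ ∀ t : ℝ≥0,
      IsCompactOperator ((semigroup (A i)).T t - (semigroup (B i)).T t) ∧
      ‖(semigroup (A i)).T t - (semigroup (B i)).T t‖ ≤ C * (1 - Real.exp (-(t : ℝ)))) :
    ∃ C : ℝ, 0 ≤ C ∧ ∀ u, IsCompactOperator (multiSemigroup A u - multiSemigroup B u) ∧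
      ‖multiSemigroup A u - multiSemigroup B u‖ ≤ C * (1 - Real.exp (-∑ i, (u i : ℝ))) := by
  induction n with
  | zero =>
    refine ⟨0, le_rfl, fun u => ?_⟩
    have : multiSemigroup A u - multiSemigroup B u = 0 := by simp [multiSemigroup]
    rw [this]
    exact ⟨isCompactOperator_zero, by simp⟩
  | succ n ih =>
    obtain ⟨C, hC0, hC⟩ := ih (fun i => A i.succ) (fun i => B i.succ) fun i => h i.succ
    obtain ⟨D, hD0, hD⟩ := h 0
    obtain ⟨M, hM0, hM⟩ := (semigroup (A 0)).exists_bound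
    obtain ⟨N, hN0, hN⟩ := exists_bound_multiSemigroup fun i => B i.succ
    refine ⟨M * C + D * N, by positivity, fun u => ?_⟩
    set P := multiSemigroup (fun i => A i.succ) (fun i => u i.succ) with hP
    set Q := multiSemigroup (fun i => B i.succ) (fun i => u i.succ) with hQ
    have hsplit : multiSemigroup A u - multiSemigroup B u
        = (semigroup (A 0)).T (u 0) * (P - Q)
          + ((semigroup (A 0)).T (u 0) - (semigroup (B 0)).T (u 0)) * Q := by
      rw [mul_sub, sub_mul, sub_add_sub_cancel]
      simp [hP, hQ, multiSemigroup, List.ofFn_succ]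
    rw [hsplit]
    refine ⟨((hC _).1.clm_comp ((semigroup (A 0)).T (u 0))).add ((hD _).1.comp_clm Q), ?_⟩
    have hs : 0 ≤ ∑ i : Fin n, (u i.succ : ℝ) := Finset.sum_nonneg fun i _ => (u i.succ).2
    have hu0 : (0 : ℝ) ≤ u 0 := (u 0).2
    have e1 : 0 ≤ 1 - Real.exp (-(u 0 : ℝ)) :=
      sub_nonneg.2 (Real.exp_le_one_iff.2 (neg_nonpos.2 hu0))
    rw [Fin.sum_univ_succ, add_mul]
    refine (norm_add_le _ _).trans (add_le_add ?_ ?_)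
    · rw [mul_assoc]
      refine (norm_mul_le _ _).trans (mul_le_mul (hM _) ((hC _).2.trans ?_) (norm_nonneg _) hM0)
      gcongr
      linarith
    · refine (norm_mul_le _ _).trans ((mul_le_mul (hD _).2 (hN _) (norm_nonneg _)
        (by positivity)).trans ?_)
      rw [mul_right_comm]
      gcongr
      linarith

end Semigroup

/-! ### Density of the joint domain. -/

section JointDomain

variable {X : Type*} [NormedAddCommGroup X] [NormedSpace ℂ X]

theorem BddC0Semigroup.continuous_toNNReal (S : BddC0Semigroup X) (x : X) :
    Continuous fun s : ℝ => S.T s.toNNReal x :=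
  (S.continuous x).comp continuous_real_toNNReal

theorem BddC0Semigroup.hasDerivAt_integral [CompleteSpace X] (S : BddC0Semigroup X) (x : X) (h : ℝ) :
    HasDerivAt (fun r : ℝ => ∫ s in (0 : ℝ)..r, S.T s.toNNReal x) (S.T h.toNNReal x) h :=
  (S.continuous_toNNReal x).integral_hasStrictDerivAt 0 h |>.hasDerivAt

theorem BddC0Semigroup.exists_clm_intervalIntegral [CompleteSpace X] (S : BddC0Semigroup X) {h : ℝ} (hh : 0 ≤ h) :
    ∃ L : X →L[ℂ] X, ∀ x, L x = ∫ s in (0 : ℝ)..h, S.T s.toNNReal x := by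
  obtain ⟨M, hM⟩ := S.bounded
  obtain ⟨L, hL, -⟩ := exists_clm_integral (μ := volume.restrict (Set.Ioc (0 : ℝ) h))
    (U := fun s : ℝ => S.T s.toNNReal) S.continuous_toNNReal (integrable_const M)
    (fun s => hM _)
  exact ⟨L, fun x => by rw [hL, intervalIntegral.integral_of_le hh]⟩

theorem BddC0Semigroup.hasGeneratorAt_integral [CompleteSpace X] (S : BddC0Semigroup X) (x : X) {h : ℝ}
    (hh : 0 ≤ h) :
    S.HasGeneratorAt (∫ s in (0 : ℝ)..h, S.T s.toNNReal x) (S.T h.toNNReal x - x) := by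
  have hc := S.continuous_toNNReal x
  have hi : ∀ a b : ℝ, IntervalIntegrable (fun s : ℝ => S.T s.toNNReal x) volume a b :=
    fun a b => hc.intervalIntegrable a b
  -- After the shift by `t`, the difference quotient is the slope of the primitive at `h` minus its
  -- slope at `0`.
  have h1 := (hasDerivAt_iff_tendsto_slope_zero.1 (S.hasDerivAt_integral x h)).mono_left
    (nhdsGT_le_nhdsNE 0)
  have h2 := (hasDerivAt_iff_tendsto_slope_zero.1 (S.hasDerivAt_integral x 0)).mono_left
    (nhdsGT_le_nhdsNE 0)
  have h3 := (h1.sub h2).comp tendsto_coe_nhdsGT_zero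
  simp only [Real.toNNReal_zero, S.map_zero, one_apply_eq_self] at h3
  refine h3.congr fun t => ?_
  have e1 : S.T t (∫ s in (0 : ℝ)..h, S.T s.toNNReal x)
      = ∫ s in (t : ℝ)..(h + t), S.T s.toNNReal x := by
    rw [← ContinuousLinearMap.intervalIntegral_comp_comm _ (hi 0 h)]
    have := intervalIntegral.integral_comp_add_right (a := 0) (b := h)
      (fun s : ℝ => S.T s.toNNReal x) (t : ℝ)
    rw [zero_add] at this
    rw [← this]
    refine intervalIntegral.integral_congr fun s hs => ?_
    rw [Set.uIcc_of_le hh] at hs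
    rw [Real.toNNReal_add hs.1 t.coe_nonneg, Real.toNNReal_coe, add_comm, S.T_add_apply]
  simp only [Function.comp_def, zero_add, intervalIntegral.integral_same, sub_zero]
  rw [e1, ← smul_sub, ← Complex.ofReal_inv, Complex.coe_smul,
    ← intervalIntegral.integral_add_adjacent_intervals (hi 0 t) (hi t (h + t))]
  congr 1
  abel

theorem BddC0Semigroup.tendsto_mean [CompleteSpace X] (S : BddC0Semigroup X) (x : X) :
    Tendsto (fun h : ℝ => ((h⁻¹ : ℝ) : ℂ) • ∫ s in (0 : ℝ)..h, S.T s.toNNReal x)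
      (𝓝[>] 0) (𝓝 x) := by
  have h2 := (hasDerivAt_iff_tendsto_slope_zero.1 (S.hasDerivAt_integral x 0)).mono_left
    (nhdsGT_le_nhdsNE 0)
  simpa [S.map_zero, ← Complex.coe_smul] using h2

/-- The generators of finitely many commuting semigroups have a dense joint domain. -/
theorem dense_joint [CompleteSpace X] {ι : Type*} (S : ι → BddC0Semigroup X)
    (hS : ∀ i j s t, Commute ((S i).T s) ((S j).T t)) (I : Finset ι) :
    Dense {x | ∀ i ∈ I, ∃ y, (S i).HasGeneratorAt x y} := by
  classical
  induction I using Finset.induction_on with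
  | empty => simp
  | insert a I _ ih =>
    -- Means of `x` along `S a` tend to `x` and lie in the domain for `a`. They remain in the
    -- domains for `I` because the averaging operator commutes with those semigroups.
    refine dense_closure.1 (ih.mono fun x hx => ?_)
    refine mem_closure_of_tendsto ((S a).tendsto_mean x) ?_
    filter_upwards [self_mem_nhdsWithin] with h hh
    have hh0 : (0 : ℝ) ≤ h := le_of_lt hh
    obtain ⟨L, hL⟩ := (S a).exists_clm_intervalIntegral hh0
    intro i hi
    rcases Finset.mem_insert.1 hi with rfl | hi
    · exact ⟨_, ((S i).hasGeneratorAt_integral x hh0).smul _⟩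
    · obtain ⟨y, hy⟩ := hx i hi
      rw [← hL]
      refine ⟨_, (hy.map (C := L) fun t => ?_).smul _⟩
      ext z
      simp only [mul_apply_eq_comp, hL]
      rw [← ContinuousLinearMap.intervalIntegral_comp_comm _
        (((S a).continuous_toNNReal z).intervalIntegrable 0 h)]
      refine intervalIntegral.integral_congr fun s _ => ?_
      exact congrArg (fun F : X →L[ℂ] X => F z) (hS i a t _)

theorem dense_jointDomain [CompleteSpace X] {n : ℕ} {A : Fin n → Gen X} (hA : IsCommutingFamily A) :
    Dense (jointDomain A : Set X) := by
  refine (dense_joint (fun i => semigroup (A i)) hA Finset.univ).mono fun x hx => ?_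
  simp only [jointDomain, Submodule.coe_iInf, Set.mem_iInter]
  intro i
  rw [← semigroup_generator (A i)]
  exact hx i (Finset.mem_univ i)

end JointDomain

/-! ### The compact difference before closure. -/

section Difference

variable {X : Type*} [NormedAddCommGroup X] [NormedSpace ℂ X]

theorem hasGeneratorAt_iff {A : Gen X} {x y : X} :
    (semigroup A).HasGeneratorAt x y ↔ ∃ h : x ∈ A.1.domain, A.1 ⟨x, h⟩ = y := by
  rw [← semigroup_generator A]
  constructor
  · exact fun h => ⟨⟨y, h⟩, tendsto_nhds_unique ((semigroup A).generator_spec ⟨x, ⟨y, h⟩⟩) h⟩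
  · rintro ⟨h, rfl⟩
    exact (semigroup A).generator_spec ⟨x, h⟩

theorem semigroup_sub_compact_of_generator [CompleteSpace X] {A B : Gen X} (hdom : A.1.domain = B.1.domain)
    (hcpt : IsCompactPMap (A.1 - B.1)) :
    ∃ C : ℝ, 0 ≤ C ∧ ∀ t : ℝ≥0,
      IsCompactOperator ((semigroup A).T t - (semigroup B).T t) ∧
      ‖(semigroup A).T t - (semigroup B).T t‖ ≤ C * (1 - Real.exp (-(t : ℝ))) := by
  obtain ⟨hd, K, hKc, hK⟩ := hcpt
  -- Density of the domain of `B` is read off from that of `A - B`, which it contains.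
  refine semigroup_sub_compact hKc (fun x y hxy => ?_) (hd.mono ?_)
  · obtain ⟨h, rfl⟩ := hasGeneratorAt_iff.1 hxy
    have hA : x ∈ A.1.domain := hdom ▸ h
    have := hK ⟨x, hA, h⟩
    rw [LinearPMap.sub_apply] at this
    exact hasGeneratorAt_iff.2 ⟨hA, by rw [← this, add_sub_cancel]⟩
  · intro x hx
    exact ⟨_, hasGeneratorAt_iff.2 ⟨hx.2, rfl⟩⟩

/-- On their common domain, the operators that define `ψ(A)` and `ψ(B)` differ by a compact
operator. This holds for arbitrary representing data, so that `ψ` enters only through its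
integral representation. -/
theorem preValue_eq_vadd [CompleteSpace X] {n : ℕ} (d : LevyData n) {A B : Fin n → Gen X}
    (hdom : ∀ i, (A i).1.domain = (B i).1.domain)
    (hcpt : ∀ i, IsCompactPMap ((A i).1 - (B i).1)) :
    ∃ K : X →L[ℂ] X, IsCompactOperator K ∧
      preValue d A = (K : X →ₗ[ℂ] X) +ᵥ preValue d B := by
  obtain ⟨C, hC0, hC⟩ := multiSemigroup_sub_compact A B fun i =>
    semigroup_sub_compact_of_generator (hdom i) (hcpt i)
  have hg : Integrable (fun u : Fin n → ℝ≥0 => C * (1 - Real.exp (-∑ i, (u i : ℝ)))) d.μ := by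
    refine ((d.integrable_exp (fun _ => -1) (fun _ => by norm_num)).const_mul (-C)).congr
      (Eventually.of_forall fun u => ?_)
    simp only [neg_one_mul, Finset.sum_neg_distrib]
    ring
  have hUc : ∀ x, Continuous fun u => (multiSemigroup A u - multiSemigroup B u) x := fun x =>
    (continuous_multiSemigroup A x).sub (continuous_multiSemigroup B x)
  obtain ⟨L, hL, -⟩ := exists_clm_integral hUc hg fun u => (hC u).2
  have hLc := isCompactOperator_of_integral hUc (fun u => (hC u).1) hg (fun u => (hC u).2) hL
  choose _ K hKc hK using hcpt
  have hsum : ∀ I : Finset (Fin n),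
      IsCompactOperator (∑ i ∈ I, (d.c₁ i : ℂ) • K i : X →L[ℂ] X) := fun I => by
    have : (∑ i ∈ I, (d.c₁ i : ℂ) • K i) ∈ compactOperator (RingHom.id ℂ) X X :=
      Submodule.sum_mem _ fun i _ => Submodule.smul_mem _ _ (hKc i)
    exact this
  have hD : jointDomain A = jointDomain B := iInf_congr hdom
  refine ⟨∑ i, (d.c₁ i : ℂ) • K i + L, (hsum _).add hLc, ?_⟩
  refine LinearPMap.ext hD fun x hxA hxB => ?_
  have hi : ∀ i, (A i).1 ⟨x, jointDomain_le A i hxA⟩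
      = K i x + (B i).1 ⟨x, jointDomain_le B i hxB⟩ := fun i => by
    have := hK i ⟨x, jointDomain_le A i hxA, jointDomain_le B i hxB⟩
    rw [LinearPMap.sub_apply] at this
    rw [← this, sub_add_cancel]
  -- On the joint domain both integrals converge separately and the two `-x` terms cancel; off it
  -- only the integral of the difference is known to converge.
  have hLx : L x = (∫ u, (multiSemigroup A u x - x) ∂d.μ)
      - ∫ u, (multiSemigroup B u x - x) ∂d.μ := by
    rw [hL, ← integral_sub (integrable_multiSemigroup_sub d A hxA)
      (integrable_multiSemigroup_sub d B hxB)]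
    simp
  have hA' : preValue d A ⟨x, hxA⟩ = (d.c₀ : ℂ) • x
      + ∑ i, (d.c₁ i : ℂ) • (A i).1 ⟨x, jointDomain_le A i hxA⟩
      + ∫ u, (multiSemigroup A u x - x) ∂d.μ := rfl
  have hB' : preValue d B ⟨x, hxB⟩ = (d.c₀ : ℂ) • x
      + ∑ i, (d.c₁ i : ℂ) • (B i).1 ⟨x, jointDomain_le B i hxB⟩
      + ∫ u, (multiSemigroup B u x - x) ∂d.μ := rfl
  rw [LinearPMap.vadd_apply, hA']
  change _ = (∑ i, (d.c₁ i : ℂ) • K i + L) x + preValue d B ⟨x, hxB⟩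
  rw [hB', add_apply, hLx]
  simp only [hi, smul_add, Finset.sum_add_distrib, sum_apply, smul_apply]
  abel

end Difference

end BochnerPhillips

theorem corollary6 {X : Type*} [NormedAddCommGroup X] [NormedSpace ℂ X] [CompleteSpace X]
    {n : ℕ} (ψ : (Fin n → ℝ) → ℝ) (hψ : BochnerPhillips.IsBernstein ψ)
    (A B : Fin n → BochnerPhillips.Gen X)
    (hA : BochnerPhillips.IsCommutingFamily A) (hB : BochnerPhillips.IsCommutingFamily B)
    (hdom : ∀ i, (A i).1.domain = (B i).1.domain)
    (hcpt : ∀ i, BochnerPhillips.IsCompactPMap ((A i).1 - (B i).1)) :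
    (BochnerPhillips.value ψ A).domain = (BochnerPhillips.value ψ B).domain ∧
      BochnerPhillips.IsCompactPMap
        (BochnerPhillips.value ψ A - BochnerPhillips.value ψ B) := by
  open BochnerPhillips in
  obtain ⟨K, hKc, hK⟩ := preValue_eq_vadd (levyData ψ) hdom hcpt
  have hv : value ψ A = (K : X →ₗ[ℂ] X) +ᵥ value ψ B := by
    rw [value, hK, closure_clm_vadd, value]
  have hdA : Dense ((value ψ A).domain : Set X) :=
    (dense_jointDomain hA).mono (LinearPMap.le_closure (preValue (levyData ψ) A)).1
  have hdB : (value ψ A).domain = (value ψ B).domain := by rw [hv, LinearPMap.vadd_domain]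
  refine ⟨hdB, ?_, K, hKc, fun x => ?_⟩
  · rw [LinearPMap.sub_domain, ← hdB, inf_idem]
    exact hdA
  · rw [LinearPMap.sub_apply]
    have h1 : value ψ A ⟨x, x.2.1⟩ = ((K : X →ₗ[ℂ] X) +ᵥ value ψ B) ⟨x, x.2.2⟩ :=
      (LinearPMap.ext_iff.1 hv).2 (x := (x : X)) (hf := x.2.1) (hg := x.2.2)
    rw [h1, LinearPMap.vadd_apply]
    exact add_sub_cancel_right _ _
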